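/- Let $\lambda_1,\lambda_2,\mu_1,\mu_2>0$ satisfy the stability condition $\mu_1>\lambda_1\left(1+\frac{\lambda_2}{\mu_2}\right)$. Consider an M/G/1 first-come-first-served queue: the interarrival times are exponentially distributed with rate $\lambda_1$, the service times are nonnegative and distributed as a random variable $Y$ whose moment generating function is given, for $s$ in a neighbourhood of $0$, by $$\phi_Y(s)=\mathbb{E}\left(e^{sY}\right)=\frac{\mu_1(\mu_2-s)}{s^2-s(\mu_2+\mu_1+\lambda_2)+\mu_1\mu_2},$$ and all interarrival and service times are mutually independent. Let $T_j$ be the system time of the $j$-th packet (the time from its arrival to its departure). Then the quadratic $$s^2-s(\mu_1+\mu_2+\lambda_2-\lambda_1)+\mu_1\mu_2-\lambda_1\mu_2-\lambda_1\lambda_2$$ has two distinct real roots $\alpha_1>\alpha_2>0$; $Y$ is integrable and $\rho:=\lambda_1\mathbb{E}(Y)=\frac{\lambda_1(\mu_2+\lambda_2)}{\mu_1\mu_2}$; and with $$C_1=\frac{(1-\rho)\mu_1(\mu_2-\alpha_1)}{\alpha_1-\alpha_2},\qquad C_2=\frac{(1-\rho)\mu_1(\mu_2-\alpha_2)}{\alpha_2-\alpha_1},$$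 the steady-state system time $T$ has the probability density $$f_T(t)=-C_1e^{-\alpha_1t}-C_2e^{-\alpha_2t},\qquad t\ge 0$$ (and $f_T(t)=0$ for $t<0$), which is nonnegative. That is, the law with density $f_T$ is the unique stationary law of the system time (the unique probability law $\pi$ such that $(T-X)^++Y$ has law $\pi$ whenever $T\sim\pi$, $X$ is exponential with rate $\lambda_1$, and $T,X,Y$ are independent), and $T_j$ converges in distribution to it as $j\to\infty$, whatever the initial backlog of work. -/

import Mathlib

open MeasureTheory ProbabilityTheory Filter Topology

noncomputable section

namespace MG1

/-- Arrival (generation) time of packet `j = 0, 1, 2, …`, where `x 0` is the time of the first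
arrival and `x (j + 1)` is the time between the arrivals of packets `j` and `j + 1`. -/
def arrivalTime (x : ℕ → ℝ) (j : ℕ) : ℝ :=
  ∑ i ∈ Finset.range (j + 1), x i

/-- Departure (delivery) time of packet `j` from a single-server first-come-first-served queue with
unlimited buffer. Packet `j` needs `y j` units of service, which starts as soon as it has arrived
and the previous packet has left; the server is occupied by work present initially until
time `w`. -/
def departureTime (w : ℝ) (x y : ℕ → ℝ) : ℕ → ℝ
  | 0 => max w (arrivalTime x 0) + y 0
  | j + 1 => max (departureTime w x y j) (arrivalTime x (j + 1)) + y (j + 1)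

/-- System time of packet `j`: the time it spends in the queue, waiting and in service. -/
def systemTime (w : ℝ) (x y : ℕ → ℝ) (j : ℕ) : ℝ :=
  departureTime w x y j - arrivalTime x j

/-- The system times satisfy Lindley's recursion `T' = (T - X)⁺ + Y`. -/
theorem systemTime_succ (w : ℝ) (x y : ℕ → ℝ) (j : ℕ) :
    systemTime w x y (j + 1) = max (systemTime w x y j - x (j + 1)) 0 + y (j + 1) := by
  have h : arrivalTime x (j + 1) = arrivalTime x j + x (j + 1) := by
    simp [arrivalTime, Finset.sum_range_succ _ (j + 1)]
  have h' : systemTime w x y j - x (j + 1)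
      = departureTime w x y j - arrivalTime x (j + 1) := by
    rw [systemTime, h]; ring
  rw [h', ← sub_self (arrivalTime x (j + 1)), max_sub_sub_right]
  simp only [systemTime, departureTime]
  ring

/-- The random input of an M/G/1 queue with arrival rate `lam` and service time law `ν`: the
interarrival times `X j` are exponential with rate `lam` (Poisson arrivals), the service times
`Y j` have law `ν`, and all these random variables are mutually independent. -/
structure IsInput {Ω : Type*} [MeasurableSpace Ω] (P : Measure Ω) (lam : ℝ) (ν : Measure ℝ)
    (X Y : ℕ → Ω → ℝ) : Prop where
  hasLaw_interarrival : ∀ j, HasLaw (X j) (expMeasure lam) P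
  hasLaw_service : ∀ j, HasLaw (Y j) ν P
  indep : iIndepFun (Sum.elim X Y) P

/-- `π` is a stationary law of the system time in the M/G/1 queue with arrival rate `lam` and
service time law `ν`: if a packet has system time `T` with law `π`, and `X`, `Y` are the
interarrival time to the next packet and the service time of the next packet, with `T`, `X`, `Y`
independent, then the system time `(T - X)⁺ + Y` of the next packet has law `π` again. -/
structure IsStationaryLaw (lam : ℝ) (ν π : Measure ℝ) : Prop where
  isProbabilityMeasure : IsProbabilityMeasure π
  map_eq : (π.prod ((expMeasure lam).prod ν)).map
    (fun p : ℝ × ℝ × ℝ => max (p.1 - p.2.1) 0 + p.2.2) = π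

/-- The measure on `ℝ` concentrated on `[0, ∞)` with density `f` there. -/
def lawOfDensity (f : ℝ → ℝ) : Measure ℝ :=
  (volume.restrict (Set.Ici 0)).withDensity (fun t => ENNReal.ofReal (f t))

end MG1

end

/-!
The system times satisfy Lindley's recursion `T' = (T - X)⁺ + Y`, and the theorem has a
probabilistic and an analytic half.

*Stability.* Run two queues on the same input with different initial backlogs. Their order is
preserved, and they meet at the latest when the one with more work becomes idle
(`MG1.systemTime_eq_or_eq_add_sum`). Until then it is a random walk with increments `Y - X`, whose
mean is negative because `ρ < 1`; by the strong law of large numbers it cannot stay nonnegative, so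
the two queues coincide from some packet on, almost surely (`MG1.eventually_systemTime_eq`). A queue
started from an independent backlog with a stationary law `π` keeps the law `π`
(`MG1.IsStationaryLaw.map_systemTime`); coupled with it, every queue converges in distribution to
`π`. The coupling is pathwise, so the backlog `W` may depend on the input. Uniqueness of the
stationary law is uniqueness of this limit.

*The stationary law.* For `X` exponential of rate `λ₁` and `T ≥ 0`, one step of the recursion reads
`(s + λ₁) M_{T'}(s) = (λ₁ M_T(s) + s M_T(-λ₁)) φ_Y(s)` on moment generating functions
(`MG1.lintegral_exp_lindley`). By partial fractions the law with density `f_T` has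
`M(s) = (1 - ρ) μ₁ (μ₂ - s) / ((α₁ - s) (α₂ - s))`, which is a fixed point of this step for `s`
near `0`; as a moment generating function near `0` determines the law
(`measure_eq_of_mgf_eventuallyEq`), the law is stationary. The quadratic with roots `α₁`, `α₂` is
negative at `μ₂`, hence `α₂ < μ₂ < α₁`; this makes both terms of `f_T` nonnegative.
-/

namespace MG1

/-! ### Coupling of two queues with the same input -/

lemma systemTime_zero (w : ℝ) (x y : ℕ → ℝ) :
    systemTime w x y 0 = max (w - x 0) 0 + y 0 := by
  simp only [systemTime, departureTime, arrivalTime, zero_add, Finset.sum_range_one]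
  rw [← sub_self (x 0), max_sub_sub_right]
  ring

lemma systemTime_mono {w w' : ℝ} (h : w ≤ w') (x y : ℕ → ℝ) (j : ℕ) :
    systemTime w x y j ≤ systemTime w' x y j := by
  induction j with
  | zero => simp only [systemTime_zero]; gcongr
  | succ j ih => simp only [systemTime_succ]; gcongr

lemma le_systemTime (w : ℝ) (x y : ℕ → ℝ) (j : ℕ) : y j ≤ systemTime w x y j := by
  cases j with
  | zero => simp [systemTime_zero]
  | succ j => simp [systemTime_succ]

/-- Two queues with the same input and ordered initial backlogs either have met, or the one with
the larger backlog has never been idle, so that its system time is an unreflected random walk: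
an idle period of the larger queue is an idle period of the smaller one, and they meet there. -/
lemma systemTime_eq_or_eq_add_sum {w w' : ℝ} (h : w ≤ w') (x y : ℕ → ℝ) (j : ℕ) :
    systemTime w x y j = systemTime w' x y j ∨
      systemTime w' x y j = w' + ∑ i ∈ Finset.range (j + 1), (y i - x i) := by
  induction j with
  | zero =>
    simp only [systemTime_zero, zero_add, Finset.sum_range_one]
    rcases le_total (w' - x 0) 0 with h0 | h0
    · left; rw [max_eq_right h0, max_eq_right (by linarith)]
    · right; rw [max_eq_left h0]; ring
  | succ j ih =>
    rw [Finset.sum_range_succ, systemTime_succ, systemTime_succ]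
    rcases ih with ih | ih
    · left; rw [ih]
    · have hm := systemTime_mono h x y j
      rcases le_total (systemTime w' x y j - x (j + 1)) 0 with h0 | h0
      · left; rw [max_eq_right h0, max_eq_right (by linarith)]
      · right; rw [max_eq_left h0, ih]; ring

/-- If the net input drifts to `-∞`, the initial backlog is eventually forgotten. -/
lemma eventually_systemTime_eq {x y : ℕ → ℝ} (hy : ∀ i, 0 ≤ y i)
    (hS : Tendsto (fun n => ∑ i ∈ Finset.range n, (y i - x i)) atTop atBot) (w w' : ℝ) :
    ∀ᶠ j in atTop, systemTime w x y j = systemTime w' x y j := by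
  wlog h : w ≤ w' generalizing w w'
  · filter_upwards [this w' w (le_of_not_ge h)] with j hj using hj.symm
  have hlt := ((tendsto_add_atTop_iff_nat 1).2 hS).eventually_lt_atBot (-w')
  filter_upwards [hlt] with j hj
  rcases systemTime_eq_or_eq_add_sum h x y j with h1 | h1
  · exact h1
  · have h2 := le_systemTime w' x y j
    have h3 := hy j
    linarith

lemma measurable_systemTime {Ω : Type*} {m : MeasurableSpace Ω} {X Y : ℕ → Ω → ℝ} {W : Ω → ℝ}
    (hW : Measurable W) {j : ℕ} (hX : ∀ i ≤ j, Measurable (X i)) (hY : ∀ i ≤ j, Measurable (Y i)) :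
    Measurable (fun ω => systemTime (W ω) (fun i => X i ω) (fun i => Y i ω) j) := by
  induction j with
  | zero =>
    simp only [systemTime_zero]
    have := hX 0 le_rfl
    have := hY 0 le_rfl
    fun_prop
  | succ j ih =>
    simp only [systemTime_succ]
    have := hX (j + 1) le_rfl
    have := hY (j + 1) le_rfl
    have := ih (fun i hi => hX i (hi.trans j.le_succ)) (fun i hi => hY i (hi.trans j.le_succ))
    fun_prop

/-! ### The Markov property -/

section Markov

variable {Ω : Type*} [MeasurableSpace Ω] {P : Measure Ω} {lam : ℝ} {ν π : Measure ℝ}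
  {X Y : ℕ → Ω → ℝ}

lemma IsInput.congr {X' Y' : ℕ → Ω → ℝ} (h : IsInput P lam ν X Y) (hX : ∀ j, X j =ᵐ[P] X' j)
    (hY : ∀ j, Y j =ᵐ[P] Y' j) : IsInput P lam ν X' Y' where
  hasLaw_interarrival j := (h.hasLaw_interarrival j).congr (hX j).symm
  hasLaw_service j := (h.hasLaw_service j).congr (hY j).symm
  indep := h.indep.congr (by rintro (i | i) <;> simp [hX, hY])

lemma IsInput.hasLaw_prodMk [IsProbabilityMeasure P] (h : IsInput P lam ν X Y) (i : ℕ) :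
    HasLaw (fun ω => (X i ω, Y i ω)) ((expMeasure lam).prod ν) P :=
  IndepFun.hasLaw_prod (h.hasLaw_interarrival i) (h.hasLaw_service i)
    (h.indep.indepFun (i := .inl i) (j := .inr i) (by simp))

/-- The system time of packet `j` is independent of the next interarrival and service times. -/
lemma IsInput.indepFun_systemTime (h : IsInput P lam ν X Y) (hX : ∀ j, Measurable (X j))
    (hY : ∀ j, Measurable (Y j)) (u : ℝ) (j : ℕ) :
    IndepFun (fun ω => systemTime u (fun i => X i ω) (fun i => Y i ω) j)
      (fun ω => (X (j + 1) ω, Y (j + 1) ω)) P := by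
  set m : ℕ ⊕ ℕ → MeasurableSpace Ω :=
    fun i => MeasurableSpace.comap (Sum.elim X Y i) inferInstance with hm
  have hle : ∀ i, m i ≤ ‹MeasurableSpace Ω› := by
    rintro (i | i)
    · exact (hX i).comap_le
    · exact (hY i).comap_le
  let S : Set (ℕ ⊕ ℕ) := {i | Sum.elim id id i ≤ j}
  let T : Set (ℕ ⊕ ℕ) := {i | Sum.elim id id i = j + 1}
  have hd : Disjoint S T := by
    rw [Set.disjoint_left]
    intro i (hi : _ ≤ j) (hi' : _ = j + 1)
    omega
  have hind : Indep (⨆ i ∈ S, m i) (⨆ i ∈ T, m i) P := indep_iSup_of_disjoint hle h.indep hd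
  have key : ∀ (R : Set (ℕ ⊕ ℕ)) (i : ℕ ⊕ ℕ), i ∈ R → Measurable[⨆ i ∈ R, m i] (Sum.elim X Y i) :=
    fun R i hi => (comap_measurable _).mono (le_iSup₂_of_le i hi le_rfl) le_rfl
  rw [IndepFun_iff_Indep]
  refine indep_of_indep_of_le_left (indep_of_indep_of_le_right hind ?_) ?_
  · have h1 : Measurable[⨆ i ∈ T, m i] (X (j + 1)) := key T (.inl (j + 1)) rfl
    have h2 : Measurable[⨆ i ∈ T, m i] (Y (j + 1)) := key T (.inr (j + 1)) rfl
    exact (h1.prodMk h2).comap_le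
  · refine Measurable.comap_le ?_
    exact measurable_systemTime measurable_const (fun i hi => key S (.inl i) hi)
      (fun i hi => key S (.inr i) hi)

lemma IsInput.lintegral_systemTime_succ [IsProbabilityMeasure P] [IsProbabilityMeasure ν]
    (hlam : 0 < lam) (h : IsInput P lam ν X Y) (hX : ∀ j, Measurable (X j))
    (hY : ∀ j, Measurable (Y j)) (u : ℝ) (j : ℕ) {f : ℝ → ENNReal} (hf : Measurable f) :
    ∫⁻ ω, f (systemTime u (fun i => X i ω) (fun i => Y i ω) (j + 1)) ∂P
      = ∫⁻ ω, ∫⁻ q, f (max (systemTime u (fun i => X i ω) (fun i => Y i ω) j - q.1) 0 + q.2)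
          ∂(expMeasure lam).prod ν ∂P := by
  have := isProbabilityMeasure_expMeasure hlam
  have hT : Measurable (fun ω => systemTime u (fun i => X i ω) (fun i => Y i ω) j) :=
    measurable_systemTime measurable_const (fun i _ => hX i) (fun i _ => hY i)
  have hlaw := IndepFun.hasLaw_prod (P := P) ⟨hT.aemeasurable, rfl⟩ (h.hasLaw_prodMk (j + 1))
    (h.indepFun_systemTime hX hY u j)
  have : IsProbabilityMeasure (P.map fun ω => systemTime u (fun i => X i ω) (fun i => Y i ω) j) :=
    Measure.isProbabilityMeasure_map hT.aemeasurable
  simp only [systemTime_succ]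
  have hg : Measurable (fun p : ℝ × ℝ × ℝ => f (max (p.1 - p.2.1) 0 + p.2.2)) := by fun_prop
  have h1 := hlaw.lintegral_comp (f := fun p : ℝ × ℝ × ℝ => f (max (p.1 - p.2.1) 0 + p.2.2))
    hg.aemeasurable
  rw [h1, lintegral_prod _ hg.aemeasurable, lintegral_map hg.lintegral_prod_right' hT]

lemma IsStationaryLaw.lintegral_eq [IsProbabilityMeasure ν] (hlam : 0 < lam)
    (hπ : IsStationaryLaw lam ν π) {f : ℝ → ENNReal} (hf : Measurable f) :
    ∫⁻ t, ∫⁻ q, f (max (t - q.1) 0 + q.2) ∂(expMeasure lam).prod ν ∂π = ∫⁻ t, f t ∂π := by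
  have := isProbabilityMeasure_expMeasure hlam
  conv_rhs => rw [← hπ.map_eq]
  rw [lintegral_map hf (by fun_prop), lintegral_prod _ (by fun_prop)]

/-- A queue started from an independent backlog with a stationary law has that law as the law of
every system time. -/
lemma IsStationaryLaw.lintegral_systemTime [IsProbabilityMeasure P] [IsProbabilityMeasure ν]
    (hlam : 0 < lam) (hπ : IsStationaryLaw lam ν π) (h : IsInput P lam ν X Y)
    (hX : ∀ j, Measurable (X j)) (hY : ∀ j, Measurable (Y j)) (j : ℕ) {f : ℝ → ENNReal}
    (hf : Measurable f) :
    ∫⁻ u, ∫⁻ ω, f (systemTime u (fun i => X i ω) (fun i => Y i ω) j) ∂P ∂π = ∫⁻ t, f t ∂π := by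
  have := isProbabilityMeasure_expMeasure hlam
  induction j generalizing f with
  | zero =>
    rw [← hπ.lintegral_eq hlam hf]
    refine lintegral_congr fun u => ?_
    simp only [systemTime_zero]
    exact (h.hasLaw_prodMk 0).lintegral_comp
      (f := fun q : ℝ × ℝ => f (max (u - q.1) 0 + q.2)) (by fun_prop)
  | succ j ih =>
    simp only [h.lintegral_systemTime_succ hlam hX hY _ j hf]
    rw [← hπ.lintegral_eq hlam hf]
    refine ih (f := fun t => ∫⁻ q, f (max (t - q.1) 0 + q.2) ∂(expMeasure lam).prod ν) ?_
    exact Measurable.lintegral_prod_right' (f := fun p : ℝ × ℝ × ℝ =>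
      f (max (p.1 - p.2.1) 0 + p.2.2)) (by fun_prop)

lemma IsStationaryLaw.map_systemTime [IsProbabilityMeasure P] [IsProbabilityMeasure ν]
    (hlam : 0 < lam) (hπ : IsStationaryLaw lam ν π) (h : IsInput P lam ν X Y)
    (hX : ∀ j, Measurable (X j)) (hY : ∀ j, Measurable (Y j)) (j : ℕ) :
    (π.prod P).map (fun p => systemTime p.1 (fun i => X i p.2) (fun i => Y i p.2) j) = π := by
  have hm : Measurable
      (fun p : ℝ × Ω => systemTime p.1 (fun i => X i p.2) (fun i => Y i p.2) j) :=
    measurable_systemTime (X := fun i (p : ℝ × Ω) => X i p.2) (Y := fun i (p : ℝ × Ω) => Y i p.2)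
      measurable_fst (fun i _ => (hX i).comp measurable_snd) (fun i _ => (hY i).comp measurable_snd)
  refine Measure.ext_of_lintegral _ fun f hf => ?_
  rw [lintegral_map hf hm, lintegral_prod
      (fun p : ℝ × Ω => f (systemTime p.1 (fun i => X i p.2) (fun i => Y i p.2) j))
      (hf.comp hm).aemeasurable, hπ.lintegral_systemTime hlam h hX hY j hf]

end Markov

/-! ### Convergence to a stationary law -/

/-- The canonical input: independent coordinates on a countable product space. -/
lemma exists_isInput {lam : ℝ} (hlam : 0 < lam) (ν : Measure ℝ) [IsProbabilityMeasure ν] :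
    ∃ (P : Measure (ℕ ⊕ ℕ → ℝ)) (_ : IsProbabilityMeasure P) (X Y : ℕ → (ℕ ⊕ ℕ → ℝ) → ℝ),
      IsInput P lam ν X Y := by
  have := isProbabilityMeasure_expMeasure hlam
  let κ : ℕ ⊕ ℕ → Measure ℝ := Sum.elim (fun _ => expMeasure lam) (fun _ => ν)
  have hκ : ∀ i, IsProbabilityMeasure (κ i) := by rintro (i | i) <;> assumption
  have hlaw : ∀ i, HasLaw (fun ω : ℕ ⊕ ℕ → ℝ => ω i) (κ i) (Measure.infinitePi κ) := fun i =>
    ⟨(measurable_pi_apply i).aemeasurable, Measure.infinitePi_map_eval κ i⟩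
  refine ⟨Measure.infinitePi κ, inferInstance, fun i ω => ω (.inl i), fun i ω => ω (.inr i),
    fun i => hlaw (.inl i), fun i => hlaw (.inr i), ?_⟩
  have := iIndepFun_infinitePi (P := κ) (X := fun _ => id) (fun _ => measurable_id)
  convert this using 1
  ext (i | i) ω <;> rfl

lemma ae_tendsto_average {Ω : Type*} [MeasurableSpace Ω] {P : Measure Ω} {μ : Measure ℝ}
    (Z : ℕ → Ω → ℝ) (hZ : ∀ i, HasLaw (Z i) μ P) (hind : iIndepFun Z P) (hint : Integrable id μ) :
    ∀ᵐ ω ∂P, Tendsto (fun n : ℕ => (∑ i ∈ Finset.range n, Z i ω) / n) atTop (𝓝 (∫ z, z ∂μ)) := by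
  have h := strong_law_ae_real Z (μ := P)
    (by
      have := hint
      rw [← (hZ 0).map_eq, integrable_map_measure (by fun_prop) (hZ 0).aemeasurable] at this
      exact this)
    (fun i j hij => hind.indepFun hij)
    (fun i => ⟨(hZ i).aemeasurable, (hZ 0).aemeasurable, (hZ i).map_eq.trans (hZ 0).map_eq.symm⟩)
  rwa [(hZ 0).integral_eq] at h

lemma IsInput.ae_tendsto_sum_atBot {Ω : Type*} [MeasurableSpace Ω] {P : Measure Ω} {lam : ℝ}
    {ν : Measure ℝ} {X Y : ℕ → Ω → ℝ} (h : IsInput P lam ν X Y)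
    (hX : Integrable id (expMeasure lam)) (hY : Integrable id ν)
    (hlt : ∫ y, y ∂ν < ∫ x, x ∂expMeasure lam) :
    ∀ᵐ ω ∂P, Tendsto (fun n => ∑ i ∈ Finset.range n, (Y i ω - X i ω)) atTop atBot := by
  filter_upwards [
    ae_tendsto_average X h.hasLaw_interarrival
      (h.indep.precomp (g := Sum.inl) Sum.inl_injective) hX,
    ae_tendsto_average Y h.hasLaw_service
      (h.indep.precomp (g := Sum.inr) Sum.inr_injective) hY] with ω h1 h2
  have h3 := (h2.sub h1).neg_mul_atTop (sub_neg.2 hlt) tendsto_natCast_atTop_atTop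
  refine h3.congr' ?_
  filter_upwards [eventually_gt_atTop 0] with n hn
  have : (n : ℝ) ≠ 0 := by positivity
  rw [Finset.sum_sub_distrib]
  field_simp

section Convergence

variable {Ω : Type*} [MeasurableSpace Ω] {P : Measure Ω} [IsProbabilityMeasure P] {lam : ℝ}
  {ν π : Measure ℝ} [IsProbabilityMeasure ν] {X Y : ℕ → Ω → ℝ}

/-- A stable queue converges in distribution to any stationary law: couple it with a queue driven
by the same input and started from an independent backlog with the stationary law. -/
lemma IsStationaryLaw.tendsto_integral_systemTime (hlam : 0 < lam) (hν : ∀ᵐ y ∂ν, 0 ≤ y)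
    (hXint : Integrable id (expMeasure lam)) (hYint : Integrable id ν)
    (hlt : ∫ y, y ∂ν < ∫ x, x ∂expMeasure lam)
    (hπ : IsStationaryLaw lam ν π) (h : IsInput P lam ν X Y) (hX : ∀ j, Measurable (X j))
    (hY : ∀ j, Measurable (Y j)) {W : Ω → ℝ} (hW : Measurable W)
    (F : BoundedContinuousFunction ℝ ℝ) :
    Tendsto (fun j => ∫ ω, F (systemTime (W ω) (fun i => X i ω) (fun i => Y i ω) j) ∂P) atTop
      (𝓝 (∫ t, F t ∂π)) := by
  have := hπ.isProbabilityMeasure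
  have hm1 : ∀ j, Measurable
      (fun p : ℝ × Ω => systemTime p.1 (fun i => X i p.2) (fun i => Y i p.2) j) := fun j =>
    measurable_systemTime (X := fun i (p : ℝ × Ω) => X i p.2) (Y := fun i (p : ℝ × Ω) => Y i p.2)
      measurable_fst (fun i _ => (hX i).comp measurable_snd) (fun i _ => (hY i).comp measurable_snd)
  have hm2 : ∀ j, Measurable
      (fun ω => systemTime (W ω) (fun i => X i ω) (fun i => Y i ω) j) := fun j =>
    measurable_systemTime hW (fun i _ => hX i) (fun i _ => hY i)
  have hF : Measurable F := F.continuous.measurable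
  have hi1 : ∀ j, Integrable
      (fun p : ℝ × Ω => F (systemTime p.1 (fun i => X i p.2) (fun i => Y i p.2) j)) (π.prod P) :=
    fun j => Integrable.of_bound (hF.comp (hm1 j)).aestronglyMeasurable ‖F‖
      (.of_forall fun _ => F.norm_coe_le_norm _)
  have hi2 : ∀ j, Integrable
      (fun p : ℝ × Ω => F (systemTime (W p.2) (fun i => X i p.2) (fun i => Y i p.2) j))
      (π.prod P) :=
    fun j => Integrable.of_bound
      (hF.comp ((hm2 j).comp measurable_snd)).aestronglyMeasurable ‖F‖
      (.of_forall fun _ => F.norm_coe_le_norm _)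
  have hpos : ∀ᵐ ω ∂P, ∀ i, 0 ≤ Y i ω := by
    rw [ae_all_iff]
    intro i
    exact ((h.hasLaw_service i).ae_iff (p := fun y => 0 ≤ y)
      (measurableSet_setOfPred.1 measurableSet_Ici)).2 hν
  have hev : ∀ᵐ p ∂π.prod P, ∀ᶠ j in atTop,
      systemTime (W p.2) (fun i => X i p.2) (fun i => Y i p.2) j
        = systemTime p.1 (fun i => X i p.2) (fun i => Y i p.2) j := by
    have hω := hpos.and (h.ae_tendsto_sum_atBot hXint hYint hlt)
    filter_upwards [Measure.quasiMeasurePreserving_snd.ae hω] with p hp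
    exact eventually_systemTime_eq hp.1 hp.2 _ _
  -- on `ℝ × Ω` the first coordinate is the stationary backlog of the coupled queue, and the second
  -- drives both queues
  have hdct := tendsto_integral_of_dominated_convergence (μ := π.prod P)
    (F := fun j (p : ℝ × Ω) => F (systemTime (W p.2) (fun i => X i p.2) (fun i => Y i p.2) j)
      - F (systemTime p.1 (fun i => X i p.2) (fun i => Y i p.2) j)) (f := fun _ => 0)
    (fun _ => ‖F‖ + ‖F‖) (fun j => ((hi2 j).sub (hi1 j)).aestronglyMeasurable)
    (integrable_const _)
    (fun j => .of_forall fun p => (norm_sub_le _ _).trans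
      (add_le_add (F.norm_coe_le_norm _) (F.norm_coe_le_norm _)))
    (by
      filter_upwards [hev] with p hp
      refine tendsto_const_nhds.congr' ?_
      filter_upwards [hp] with j hj
      rw [hj, sub_self])
  rw [integral_zero] at hdct
  have heq : ∀ j, ∫ p : ℝ × Ω,
      (F (systemTime (W p.2) (fun i => X i p.2) (fun i => Y i p.2) j)
        - F (systemTime p.1 (fun i => X i p.2) (fun i => Y i p.2) j)) ∂π.prod P
      = ∫ ω, F (systemTime (W ω) (fun i => X i ω) (fun i => Y i ω) j) ∂P - ∫ t, F t ∂π := by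
    intro j
    rw [integral_sub (hi2 j) (hi1 j)]
    congr 1
    · rw [integral_fun_snd (μ := π) (ν := P)
        (fun ω => F (systemTime (W ω) (fun i => X i ω) (fun i => Y i ω) j))]
      simp
    · conv_rhs => rw [← hπ.map_systemTime hlam h hX hY j]
      rw [integral_map (hm1 j).aemeasurable hF.aestronglyMeasurable]
  simp only [heq] at hdct
  simpa using hdct.add_const (∫ t, F t ∂π)

lemma IsStationaryLaw.tendstoInDistribution_systemTime [IsProbabilityMeasure π] (hlam : 0 < lam)
    (hν : ∀ᵐ y ∂ν, 0 ≤ y)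
    (hXint : Integrable id (expMeasure lam)) (hYint : Integrable id ν)
    (hlt : ∫ y, y ∂ν < ∫ x, x ∂expMeasure lam)
    (hπ : IsStationaryLaw lam ν π) (h : IsInput P lam ν X Y) {W : Ω → ℝ} (hW : AEMeasurable W P) :
    TendstoInDistribution
      (fun (j : ℕ) (ω : Ω) => systemTime (W ω) (fun i => X i ω) (fun i => Y i ω) j)
      atTop id (fun _ => P) π := by
  have hX := fun j => (h.hasLaw_interarrival j).aemeasurable
  have hY := fun j => (h.hasLaw_service j).aemeasurable
  have hX' := fun j => (hX j).measurable_mk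
  have hY' := fun j => (hY j).measurable_mk
  have hm : ∀ j, Measurable (fun ω => systemTime (hW.mk W ω) (fun i => (hX i).mk (X i) ω)
      (fun i => (hY i).mk (Y i) ω) j) := fun j =>
    measurable_systemTime hW.measurable_mk (fun i _ => hX' i) (fun i _ => hY' i)
  have key : TendstoInDistribution (fun (j : ℕ) (ω : Ω) => systemTime (hW.mk W ω)
      (fun i => (hX i).mk (X i) ω) (fun i => (hY i).mk (Y i) ω) j) atTop id (fun _ => P) π :=
    { forall_aemeasurable := fun j => (hm j).aemeasurable
      aemeasurable_limit := aemeasurable_id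
      tendsto := by
        refine ProbabilityMeasure.tendsto_iff_forall_integral_tendsto.2 fun F => ?_
        have hF : Measurable F := F.continuous.measurable
        have := hπ.tendsto_integral_systemTime hlam hν hXint hYint hlt
          (h.congr (fun j => (hX j).ae_eq_mk) (fun j => (hY j).ae_eq_mk)) hX' hY'
          hW.measurable_mk F
        simpa [integral_map (hm _).aemeasurable hF.aestronglyMeasurable] using this }
  refine key.congr (fun j => ?_) (ae_eq_refl _)
  filter_upwards [hW.ae_eq_mk, ae_all_iff.2 fun i => (hX i).ae_eq_mk,
    ae_all_iff.2 fun i => (hY i).ae_eq_mk] with ω h1 h2 h3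
  simp only [← h1, ← h2, ← h3]

/-- All stationary laws are the limit law of the queue that starts empty. -/
lemma IsStationaryLaw.unique {π' : Measure ℝ} (hlam : 0 < lam) (hν : ∀ᵐ y ∂ν, 0 ≤ y)
    (hXint : Integrable id (expMeasure lam)) (hYint : Integrable id ν)
    (hlt : ∫ y, y ∂ν < ∫ x, x ∂expMeasure lam)
    (hπ : IsStationaryLaw lam ν π) (hπ' : IsStationaryLaw lam ν π') : π = π' := by
  have := hπ.isProbabilityMeasure
  have := hπ'.isProbabilityMeasure
  obtain ⟨P, hP, X, Y, h⟩ := exists_isInput hlam ν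
  have h1 := hπ.tendstoInDistribution_systemTime hlam hν hXint hYint hlt h
    (W := fun _ => 0) aemeasurable_const
  have h2 := hπ'.tendstoInDistribution_systemTime hlam hν hXint hYint hlt h
    (W := fun _ => 0) aemeasurable_const
  simpa using tendstoInDistribution_unique _ h1 h2

end Convergence

end MG1

/-! ### Moment generating functions near the origin -/

section MGF

open Complex in
/-- Two finite measures on `ℝ` whose moment generating functions are finite and equal near `0`
are equal: the complex moment generating functions are analytic on a vertical strip around the
imaginary axis, so they agree on that axis, where they are the characteristic functions. -/
lemma measure_eq_of_mgf_eventuallyEq {μ μ' : Measure ℝ} [IsFiniteMeasure μ] [IsFiniteMeasure μ']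
    (hμ : 0 ∈ interior (integrableExpSet id μ)) (hμ' : 0 ∈ interior (integrableExpSet id μ'))
    (h : mgf id μ =ᶠ[𝓝 0] mgf id μ') : μ = μ' := by
  set A := interior (integrableExpSet id μ) ∩ interior (integrableExpSet id μ') with hA
  have hconv : Convex ℝ A := convex_integrableExpSet.interior.inter convex_integrableExpSet.interior
  have h1 : AnalyticOnNhd ℂ (complexMGF id μ) {z | z.re ∈ A} :=
    analyticOnNhd_complexMGF.mono fun z hz => hz.1
  have h2 : AnalyticOnNhd ℂ (complexMGF id μ') {z | z.re ∈ A} :=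
    analyticOnNhd_complexMGF.mono fun z hz => hz.2
  have heq : Set.EqOn (complexMGF id μ) (complexMGF id μ') {z | z.re ∈ A} := by
    refine h1.eqOn_of_preconnected_of_frequently_eq h2
      (hconv.linear_preimage reLm).isPreconnected (z₀ := 0) (by simp [hA, hμ, hμ']) ?_
    have hfr : ∃ᶠ x : ℝ in 𝓝[≠] 0, complexMGF id μ x = complexMGF id μ' x := by
      refine Eventually.frequently ?_
      filter_upwards [h.filter_mono nhdsWithin_le_nhds] with x hx
      rw [complexMGF_ofReal, complexMGF_ofReal, hx]
    have ht : Tendsto (fun x : ℝ => (x : ℂ)) (𝓝[≠] 0) (𝓝[≠] 0) := by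
      refine tendsto_nhdsWithin_iff.2 ⟨?_, ?_⟩
      · exact (continuous_ofReal.tendsto' 0 0 rfl).mono_left nhdsWithin_le_nhds
      · filter_upwards [self_mem_nhdsWithin] with x hx
        simpa using hx
    exact ht.frequently hfr
  refine Measure.ext_of_charFun ?_
  ext t
  rw [← complexMGF_id_mul_I, ← complexMGF_id_mul_I]
  exact heq (by simp [hA, hμ, hμ'])

/-- A moment generating function that agrees near `0` with a function continuous and nonzero at
`0` is finite near `0`, because the integral of a non-integrable function is `0` by convention. -/
lemma zero_mem_interior_integrableExpSet {μ : Measure ℝ} {g : ℝ → ℝ} (hg : ContinuousAt g 0)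
    (h0 : g 0 ≠ 0) (h : mgf id μ =ᶠ[𝓝 0] g) : 0 ∈ interior (integrableExpSet id μ) := by
  rw [mem_interior_iff_mem_nhds]
  filter_upwards [h, hg.eventually_ne h0] with s hs hs0
  by_contra hn
  exact hs0 (hs ▸ mgf_undef hn)

lemma mgf_eq_of_lintegral_eq {μ : Measure ℝ} {s r : ℝ} (hr : 0 ≤ r)
    (h : ∫⁻ x, ENNReal.ofReal (Real.exp (s * x)) ∂μ = ENNReal.ofReal r) : mgf id μ s = r := by
  rw [mgf, integral_eq_lintegral_of_nonneg_ae (.of_forall fun _ => (Real.exp_pos _).le)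
    (by fun_prop)]
  simp [h, hr]

lemma integrable_exp_of_lintegral_eq {μ : Measure ℝ} {s r : ℝ}
    (h : ∫⁻ x, ENNReal.ofReal (Real.exp (s * x)) ∂μ = ENNReal.ofReal r) :
    Integrable (fun x => Real.exp (s * x)) μ := by
  refine ⟨by fun_prop, ?_⟩
  rw [hasFiniteIntegral_iff_ofReal (.of_forall fun _ => (Real.exp_pos _).le), h]
  exact ENNReal.ofReal_lt_top

lemma lintegral_exp_eq_mgf {μ : Measure ℝ} {s : ℝ} (h : s ∈ integrableExpSet id μ) :
    ∫⁻ x, ENNReal.ofReal (Real.exp (s * x)) ∂μ = ENNReal.ofReal (mgf id μ s) :=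
  (ofReal_integral_eq_lintegral_ofReal h (.of_forall fun _ => (Real.exp_pos _).le)).symm

end MGF

namespace MG1

/-! ### Mixtures of exponential laws -/

lemma lintegral_lawOfDensity {f : ℝ → ℝ} (hf : Measurable f) {g : ℝ → ENNReal}
    (hg : Measurable g) :
    ∫⁻ x, g x ∂lawOfDensity f = ∫⁻ x in Set.Ici 0, ENNReal.ofReal (f x) * g x := by
  rw [lawOfDensity, lintegral_withDensity_eq_lintegral_mul _ (by fun_prop) hg]
  rfl

lemma integral_Ici_exp_neg_mul {b : ℝ} (hb : 0 < b) :
    IntegrableOn (fun t => Real.exp (-b * t)) (Set.Ici 0) ∧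
      ∫ t in Set.Ici (0 : ℝ), Real.exp (-b * t) = 1 / b := by
  rw [integrableOn_Ici_iff_integrableOn_Ioi, integral_Ici_eq_integral_Ioi]
  refine ⟨integrableOn_exp_mul_Ioi (neg_neg_of_pos hb) 0, ?_⟩
  rw [integral_exp_mul_Ioi (neg_neg_of_pos hb)]
  simp

/-- The moment generating function of a mixture of two exponential laws. -/
lemma lintegral_exp_lawOfDensity {a₁ a₂ c₁ c₂ s : ℝ} (hc₁ : 0 ≤ c₁) (hc₂ : 0 ≤ c₂) (h₁ : s < a₁)
    (h₂ : s < a₂) :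
    ∫⁻ t, ENNReal.ofReal (Real.exp (s * t))
        ∂lawOfDensity (fun t => c₁ * Real.exp (-a₁ * t) + c₂ * Real.exp (-a₂ * t))
      = ENNReal.ofReal (c₁ / (a₁ - s) + c₂ / (a₂ - s)) := by
  rw [lintegral_lawOfDensity (by fun_prop) (by fun_prop)]
  obtain ⟨i₁, e₁⟩ := integral_Ici_exp_neg_mul (sub_pos.2 h₁)
  obtain ⟨i₂, e₂⟩ := integral_Ici_exp_neg_mul (sub_pos.2 h₂)
  have key : ∀ t, ENNReal.ofReal (c₁ * Real.exp (-a₁ * t) + c₂ * Real.exp (-a₂ * t))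
      * ENNReal.ofReal (Real.exp (s * t))
      = ENNReal.ofReal (c₁ * Real.exp (-(a₁ - s) * t) + c₂ * Real.exp (-(a₂ - s) * t)) := by
    intro t
    rw [← ENNReal.ofReal_mul (by positivity)]
    congr 1
    rw [add_mul, mul_assoc, mul_assoc, ← Real.exp_add, ← Real.exp_add]
    ring_nf
  simp only [key]
  have i : IntegrableOn
      (fun t => c₁ * Real.exp (-(a₁ - s) * t) + c₂ * Real.exp (-(a₂ - s) * t)) (Set.Ici 0) :=
    Integrable.add (i₁.const_mul c₁) (i₂.const_mul c₂)
  rw [← ofReal_integral_eq_lintegral_ofReal i (.of_forall fun _ => by positivity),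
    integral_add (i₁.const_mul _) (i₂.const_mul _), integral_const_mul, integral_const_mul, e₁, e₂]
  ring_nf

lemma isProbabilityMeasure_lawOfDensity {a₁ a₂ c₁ c₂ : ℝ} (hc₁ : 0 ≤ c₁) (hc₂ : 0 ≤ c₂)
    (h₁ : 0 < a₁) (h₂ : 0 < a₂) (h : c₁ / a₁ + c₂ / a₂ = 1) :
    IsProbabilityMeasure
      (lawOfDensity (fun t => c₁ * Real.exp (-a₁ * t) + c₂ * Real.exp (-a₂ * t))) where
  measure_univ := by
    simpa [h] using lintegral_exp_lawOfDensity hc₁ hc₂ h₁ h₂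

lemma expMeasure_eq_lawOfDensity (lam : ℝ) :
    expMeasure lam = lawOfDensity (fun t => lam * Real.exp (-lam * t)) := by
  rw [lawOfDensity, ← withDensity_indicator measurableSet_Ici, expMeasure, gammaMeasure]
  congr 1
  ext t
  have := exponentialPDF_eq lam t
  rw [exponentialPDF, exponentialPDFReal] at this
  rw [gammaPDF, this, Set.indicator_apply]
  split_ifs with h1 h2 h2
  · rw [neg_mul]
  · exact absurd h1 h2
  · exact absurd h2 h1
  · simp

lemma mgf_expMeasure {lam : ℝ} (hlam : 0 < lam) :
    mgf id (expMeasure lam) =ᶠ[𝓝 0] fun s => lam / (lam - s) := by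
  filter_upwards [eventually_lt_nhds hlam] with s hs
  refine mgf_eq_of_lintegral_eq (div_nonneg hlam.le (sub_nonneg.2 hs.le)) ?_
  have := lintegral_exp_lawOfDensity (c₁ := lam) (c₂ := 0) hlam.le le_rfl hs hs
  simpa [expMeasure_eq_lawOfDensity] using this

/-- The mean is the derivative at `0` of any formula for the moment generating function near `0`.
That the formula is nonzero at `0` excludes the value `0` given to a divergent integral. -/
lemma integrable_and_integral_eq_of_mgf {μ : Measure ℝ} {g : ℝ → ℝ} {m : ℝ}
    (hg : HasDerivAt g m 0) (h0 : g 0 ≠ 0) (h : mgf id μ =ᶠ[𝓝 0] g) :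
    Integrable id μ ∧ ∫ x, x ∂μ = m := by
  have hint := zero_mem_interior_integrableExpSet hg.continuousAt h0 h
  refine ⟨integrable_of_mem_interior_integrableExpSet hint, ?_⟩
  have := deriv_mgf_zero hint
  rw [(hg.congr_of_eventuallyEq h).deriv] at this
  exact this.symm

lemma expMeasure_mean {lam : ℝ} (hlam : 0 < lam) :
    Integrable id (expMeasure lam) ∧ ∫ x, x ∂expMeasure lam = 1 / lam := by
  refine integrable_and_integral_eq_of_mgf ?_ ?_ (mgf_expMeasure hlam)
  · have := (hasDerivAt_const (0 : ℝ) lam).div ((hasDerivAt_id (0 : ℝ)).const_sub lam)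
      (by simpa using hlam.ne')
    convert! this using 1
    simp only [id, sub_zero]
    field_simp
    simp
  · simp [hlam.ne']

/-! ### Lindley's recursion on moment generating functions -/

/-- The moment generating function of `(t - X)⁺` for `X` exponential. -/
lemma lintegral_exp_max_expMeasure {lam s t : ℝ} (hlam : 0 < lam) (hs : -lam < s) (ht : 0 ≤ t) :
    ∫⁻ x, ENNReal.ofReal (Real.exp (s * max (t - x) 0)) ∂expMeasure lam
      = ENNReal.ofReal ((lam * Real.exp (s * t) + s * Real.exp (-lam * t)) / (s + lam)) := by
  have hpos : 0 < s + lam := by linarith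
  rw [expMeasure_eq_lawOfDensity, lintegral_lawOfDensity (by fun_prop) (by fun_prop)]
  have key : ∀ x, ENNReal.ofReal (lam * Real.exp (-lam * x))
      * ENNReal.ofReal (Real.exp (s * max (t - x) 0))
      = ENNReal.ofReal (lam * Real.exp (-lam * x) * Real.exp (s * max (t - x) 0)) := fun x =>
    (ENNReal.ofReal_mul (by positivity)).symm
  simp only [key]
  set F : ℝ → ℝ := fun x => lam * Real.exp (-lam * x) * Real.exp (s * max (t - x) 0) with hF
  have hFc : Continuous F := by fun_prop
  have hF2 : Set.EqOn F (fun x => lam * Real.exp (-lam * x)) (Set.Ioi t) := by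
    intro x (hx : t < x)
    simp [hF, max_eq_right (sub_nonpos.2 hx.le)]
  have i1 : IntegrableOn F (Set.Icc 0 t) := hFc.integrableOn_Icc
  have i2 : IntegrableOn F (Set.Ioi t) :=
    IntegrableOn.congr_fun (Integrable.const_mul
      (integrableOn_exp_mul_Ioi (neg_neg_of_pos hlam) t) lam) hF2.symm measurableSet_Ioi
  have e2 : ∫ x in Set.Ioi t, F x = Real.exp (-lam * t) := by
    rw [setIntegral_congr_fun measurableSet_Ioi hF2, integral_const_mul,
      integral_exp_mul_Ioi (neg_neg_of_pos hlam)]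
    field_simp
  have e1 : ∫ x in Set.Icc 0 t, F x
      = lam / (s + lam) * (Real.exp (s * t) - Real.exp (-lam * t)) := by
    have hcongr : Set.EqOn F (fun x => lam * Real.exp (s * t) * Real.exp (-(s + lam) * x))
        (Set.Icc 0 t) := by
      intro x hx
      simp only [hF, max_eq_left (sub_nonneg.2 hx.2), mul_assoc, ← Real.exp_add]
      ring_nf
    rw [setIntegral_congr_fun measurableSet_Icc hcongr, integral_Icc_eq_integral_Ioc,
      ← intervalIntegral.integral_of_le ht, intervalIntegral.integral_const_mul,
      intervalIntegral.integral_comp_mul_left (fun x => Real.exp x) (neg_neg_of_pos hpos).ne,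
      integral_exp]
    have : Real.exp (s * t) * Real.exp (-(s + lam) * t) = Real.exp (-lam * t) := by
      rw [← Real.exp_add]; ring_nf
    rw [← this, inv_neg, mul_zero, Real.exp_zero, smul_eq_mul]
    field_simp
    ring
  have hun : Set.Ici (0 : ℝ) = Set.Icc 0 t ∪ Set.Ioi t := (Set.Icc_union_Ioi_eq_Ici ht).symm
  have hdisj : Disjoint (Set.Icc 0 t) (Set.Ioi t) :=
    Set.disjoint_left.2 fun x h1 h2 => absurd h2 (not_lt.2 h1.2)
  rw [← ofReal_integral_eq_lintegral_ofReal (by rw [hun]; exact i1.union i2)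
    (.of_forall fun x => by positivity), hun,
    setIntegral_union hdisj measurableSet_Ioi i1 i2, e1, e2]
  congr 1
  field_simp
  ring

/-- One step of Lindley's recursion `T' = (T - X)⁺ + Y` on moment generating functions:
`(s + λ) M_{T'}(s) = (λ M_T(s) + s M_T(-λ)) φ_Y(s)`. -/
lemma lintegral_exp_lindley {lam s : ℝ} {ν π : Measure ℝ} [IsProbabilityMeasure ν] [SFinite π]
    (hlam : 0 < lam) (hs : -lam < s) (hπ0 : ∀ᵐ t ∂π, 0 ≤ t) (hνs : s ∈ integrableExpSet id ν)
    (hπs : s ∈ integrableExpSet id π) (hπl : -lam ∈ integrableExpSet id π) :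
    ∫⁻ z, ENNReal.ofReal (Real.exp (s * z)) ∂(π.prod ((expMeasure lam).prod ν)).map
        (fun p : ℝ × ℝ × ℝ => max (p.1 - p.2.1) 0 + p.2.2)
      = ENNReal.ofReal
        ((lam * mgf id π s + s * mgf id π (-lam)) / (s + lam) * mgf id ν s) := by
  have := isProbabilityMeasure_expMeasure hlam
  have hpos : 0 < s + lam := by linarith
  have hi : Integrable (fun t =>
      (lam * Real.exp (s * t) + s * Real.exp (-lam * t)) / (s + lam)) π :=
    (((show Integrable (fun t => Real.exp (s * t)) π from hπs).const_mul lam).add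
      ((show Integrable (fun t => Real.exp (-lam * t)) π from hπl).const_mul s)).div_const _
  have hnn : ∀ᵐ t ∂π, 0 ≤ (lam * Real.exp (s * t) + s * Real.exp (-lam * t)) / (s + lam) := by
    filter_upwards [hπ0] with t ht
    have h1 : Real.exp (-lam * t) ≤ Real.exp (s * t) := by gcongr
    have h2 := Real.exp_pos (-lam * t)
    refine div_nonneg ?_ hpos.le
    nlinarith
  have hint : ∫ t, (lam * Real.exp (s * t) + s * Real.exp (-lam * t)) / (s + lam) ∂π
      = (lam * mgf id π s + s * mgf id π (-lam)) / (s + lam) := by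
    rw [integral_div, integral_add
      ((show Integrable (fun t => Real.exp (s * t)) π from hπs).const_mul lam)
      ((show Integrable (fun t => Real.exp (-lam * t)) π from hπl).const_mul s),
      integral_const_mul, integral_const_mul]
    rfl
  rw [lintegral_map (by fun_prop) (by fun_prop), lintegral_prod _ (by fun_prop)]
  have hin : ∀ t, ∫⁻ q : ℝ × ℝ, ENNReal.ofReal (Real.exp (s * (max (t - q.1) 0 + q.2)))
      ∂(expMeasure lam).prod ν
      = (∫⁻ x, ENNReal.ofReal (Real.exp (s * max (t - x) 0)) ∂expMeasure lam)
        * ENNReal.ofReal (mgf id ν s) := by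
    intro t
    rw [← lintegral_exp_eq_mgf hνs, ← lintegral_prod_mul (by fun_prop) (by fun_prop)]
    refine lintegral_congr fun q => ?_
    rw [mul_add, Real.exp_add, ENNReal.ofReal_mul (Real.exp_pos _).le]
  simp only [hin]
  rw [lintegral_mul_const _ (Measurable.lintegral_prod_right'
    (f := fun p : ℝ × ℝ => ENNReal.ofReal (Real.exp (s * max (p.1 - p.2) 0))) (by fun_prop))]
  rw [lintegral_congr_ae (hπ0.mono fun t ht => lintegral_exp_max_expMeasure hlam hs ht),
    ← ofReal_integral_eq_lintegral_ofReal hi hnn, ← ENNReal.ofReal_mul (integral_nonneg_of_ae hnn),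
    hint]

/-! ### The stationary law -/

/-- A monic quadratic with positive constant coefficient that is negative at some `m > 0` has two
positive roots, on both sides of `m`. -/
lemma exists_roots_of_neg {b c m : ℝ} (hm : 0 < m) (hc : 0 < c) (h : m ^ 2 - m * b + c < 0) :
    ∃ r₁ r₂ : ℝ, 0 < r₂ ∧ r₂ < m ∧ m < r₁ ∧ r₁ + r₂ = b ∧ r₁ * r₂ = c := by
  have hd : 0 ≤ b ^ 2 - 4 * c := by nlinarith [sq_nonneg (2 * m - b)]
  have hsq := Real.sq_sqrt hd
  have hs0 := Real.sqrt_nonneg (b ^ 2 - 4 * c)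
  set d := Real.sqrt (b ^ 2 - 4 * c)
  have hlt : |2 * m - b| < d := abs_lt_of_sq_lt_sq (by nlinarith) hs0
  obtain ⟨h1, h2⟩ := abs_lt.1 hlt
  have hprod : (b + d) / 2 * ((b - d) / 2) = c := by linear_combination -hsq / 4
  refine ⟨(b + d) / 2, (b - d) / 2, ?_, by linarith, by linarith, by ring, hprod⟩
  exact pos_of_mul_pos_right (hprod ▸ hc) (by linarith : 0 ≤ (b + d) / 2)

section

variable {lam1 lam2 mu1 mu2 α1 α2 c1 c2 ρ : ℝ} {ν : Measure ℝ}

lemma service_mean (hmu1 : 0 < mu1) (hmu2 : 0 < mu2)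
    (hmgf : ∀ᶠ s in 𝓝 (0 : ℝ),
      mgf id ν s = mu1 * (mu2 - s) / (s ^ 2 - s * (mu2 + mu1 + lam2) + mu1 * mu2)) :
    Integrable id ν ∧ ∫ y, y ∂ν = (mu2 + lam2) / (mu1 * mu2) := by
  refine integrable_and_integral_eq_of_mgf ?_ ?_ hmgf
  · have h1 : HasDerivAt (fun s : ℝ => mu1 * (mu2 - s)) (mu1 * (-1)) 0 :=
      ((hasDerivAt_id (0 : ℝ)).const_sub mu2).const_mul mu1
    have h2 : HasDerivAt (fun s : ℝ => s ^ 2 - s * (mu2 + mu1 + lam2) + mu1 * mu2)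
        (-(mu2 + mu1 + lam2)) 0 := by
      have := (((hasDerivAt_id (0 : ℝ)).pow 2).sub
        ((hasDerivAt_id (0 : ℝ)).mul_const (mu2 + mu1 + lam2))).add_const (mu1 * mu2)
      simpa using this
    have := h1.div h2 (by simp [hmu1.ne', hmu2.ne'])
    convert! this using 1
    simp only [sub_zero, zero_mul, zero_pow two_ne_zero, zero_add]
    field_simp
    ring
  · simp [hmu1.ne', hmu2.ne']

/-- Evaluates the moment generating function of the stationary law, where `k = (1 - ρ) μ₁`. -/
lemma partial_fractions {k s : ℝ} (hα : α1 ≠ α2) (h1 : α1 - s ≠ 0) (h2 : α2 - s ≠ 0) :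
    k * (α1 - mu2) / (α1 - α2) / (α1 - s) + k * (mu2 - α2) / (α1 - α2) / (α2 - s)
      = k * (mu2 - s) / ((α1 - s) * (α2 - s)) := by
  have : α1 - α2 ≠ 0 := sub_ne_zero.2 hα
  field_simp
  ring

/-- The mixture of exponential laws given by the Pollaczek-Khinchine formula is stationary. -/
lemma isStationaryLaw_lawOfDensity [IsProbabilityMeasure ν] (hlam1 : 0 < lam1)
    (hmu1 : 0 < mu1) (hmu2 : 0 < mu2)
    (hmgf : ∀ᶠ s in 𝓝 (0 : ℝ),
      mgf id ν s = mu1 * (mu2 - s) / (s ^ 2 - s * (mu2 + mu1 + lam2) + mu1 * mu2))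
    (hα2 : 0 < α2) (hα2' : α2 < mu2) (hα1 : mu2 < α1)
    (hsum : α1 + α2 = mu1 + mu2 + lam2 - lam1)
    (hprod : α1 * α2 = mu1 * mu2 - lam1 * mu2 - lam1 * lam2)
    (hρ : ρ = lam1 * (mu2 + lam2) / (mu1 * mu2))
    (hc1 : c1 = (1 - ρ) * mu1 * (α1 - mu2) / (α1 - α2))
    (hc2 : c2 = (1 - ρ) * mu1 * (mu2 - α2) / (α1 - α2)) :
    0 ≤ c1 ∧ 0 ≤ c2 ∧ IsStationaryLaw lam1 ν
      (lawOfDensity (fun t => c1 * Real.exp (-α1 * t) + c2 * Real.exp (-α2 * t))) := by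
  have hα1pos : 0 < α1 := hmu2.trans hα1
  have hρ' : (1 - ρ) * mu1 * mu2 = α1 * α2 := by
    rw [hρ, hprod]; field_simp; ring
  have hk : 0 < (1 - ρ) * mu1 :=
    pos_of_mul_pos_left (hρ' ▸ mul_pos hα1pos hα2) hmu2.le
  have h1 : 0 ≤ c1 := by
    rw [hc1]; exact div_nonneg (mul_nonneg hk.le (by linarith)) (by linarith)
  have h2 : 0 ≤ c2 := by
    rw [hc2]; exact div_nonneg (mul_nonneg hk.le (by linarith)) (by linarith)
  refine ⟨h1, h2, ?_⟩
  set π := lawOfDensity (fun t => c1 * Real.exp (-α1 * t) + c2 * Real.exp (-α2 * t)) with hπ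
  have hL : ∀ s < α2, 0 ≤ c1 / (α1 - s) + c2 / (α2 - s) ∧
      ∫⁻ t, ENNReal.ofReal (Real.exp (s * t)) ∂π
        = ENNReal.ofReal (c1 / (α1 - s) + c2 / (α2 - s)) := by
    intro s hs
    exact ⟨add_nonneg (div_nonneg h1 (by linarith)) (div_nonneg h2 (by linarith)),
      lintegral_exp_lawOfDensity h1 h2 (by linarith) hs⟩
  have hM : ∀ s < α2, mgf id π s = (1 - ρ) * mu1 * (mu2 - s) / ((α1 - s) * (α2 - s)) := by
    intro s hs
    rw [mgf_eq_of_lintegral_eq (hL s hs).1 (hL s hs).2, hc1, hc2]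
    exact partial_fractions (by linarith) (by linarith) (by linarith)
  have hI : ∀ s < α2, s ∈ integrableExpSet id π := fun s hs =>
    integrable_exp_of_lintegral_eq (hL s hs).2
  have hprob : IsProbabilityMeasure π := by
    refine isProbabilityMeasure_lawOfDensity h1 h2 hα1pos hα2 ?_
    have := partial_fractions (α1 := α1) (α2 := α2) (mu2 := mu2) (k := (1 - ρ) * mu1) (s := 0)
      (by linarith) (by linarith) (by linarith)
    rw [sub_zero, sub_zero, sub_zero, ← hc1, ← hc2, hρ'] at this
    rw [this, div_self (by positivity)]
  have hπ0 : ∀ᵐ t ∂π, 0 ≤ t :=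
    (withDensity_absolutelyContinuous _ _).ae_le (ae_restrict_mem measurableSet_Ici)
  have hMl : mgf id π (-lam1) = 1 - ρ := by
    have hne : (α1 - -lam1) * (α2 - -lam1) ≠ 0 := by
      have : 0 < α1 - -lam1 := by linarith
      have : 0 < α2 - -lam1 := by linarith
      positivity
    rw [hM _ (by linarith), div_eq_iff hne]
    linear_combination (-(1 - ρ)) * (hprod + lam1 * hsum)
  have hνint : (0 : ℝ) ∈ interior (integrableExpSet id ν) :=
    zero_mem_interior_integrableExpSet
      (by
        refine ContinuousAt.div (by fun_prop) (by fun_prop) ?_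
        simp [hmu1.ne', hmu2.ne'])
      (by simp [hmu1.ne', hmu2.ne']) hmgf
  have := isProbabilityMeasure_expMeasure hlam1
  have hstep : ∀ᶠ s in 𝓝 (0 : ℝ), ∫⁻ z, ENNReal.ofReal (Real.exp (s * z))
      ∂(π.prod ((expMeasure lam1).prod ν)).map
        (fun p : ℝ × ℝ × ℝ => max (p.1 - p.2.1) 0 + p.2.2)
      = ENNReal.ofReal (mgf id π s) := by
    have hD : ∀ᶠ s in 𝓝 (0 : ℝ), s ^ 2 - s * (mu2 + mu1 + lam2) + mu1 * mu2 ≠ 0 :=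
      (show ContinuousAt (fun s : ℝ => s ^ 2 - s * (mu2 + mu1 + lam2) + mu1 * mu2) 0 by
        fun_prop).eventually_ne (by simp [hmu1.ne', hmu2.ne'])
    filter_upwards [hmgf, hD, eventually_lt_nhds hα2, eventually_gt_nhds (neg_neg_of_pos hlam1),
      mem_interior_iff_mem_nhds.1 hνint] with s hs hDs hsα hsl hνs
    rw [lintegral_exp_lindley hlam1 hsl hπ0 hνs (hI s hsα) (hI _ (by linarith)), hMl, hM s hsα, hs]
    congr 1
    have e1 : α1 - s ≠ 0 := by linarith
    have e2 : α2 - s ≠ 0 := by linarith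
    have e3 : s + lam1 ≠ 0 := by linarith
    -- `s (α₁ - s) (α₂ - s) + λ₁ μ₁ (μ₂ - s) = (s + λ₁) D(s)`, where `D` is the denominator of `φ_Y`
    have hQ : s * ((α1 - s) * (α2 - s)) + lam1 * (mu1 * (mu2 - s))
        = (s + lam1) * (s ^ 2 - s * (mu2 + mu1 + lam2) + mu1 * mu2) := by
      linear_combination s * hprod - s ^ 2 * hsum
    have hfrac : lam1 * ((1 - ρ) * mu1 * (mu2 - s) / ((α1 - s) * (α2 - s))) + s * (1 - ρ)
        = (1 - ρ) * ((s + lam1) * (s ^ 2 - s * (mu2 + mu1 + lam2) + mu1 * mu2))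
          / ((α1 - s) * (α2 - s)) := by
      rw [← hQ]; field_simp; ring
    rw [hfrac]
    generalize s ^ 2 - s * (mu2 + mu1 + lam2) + mu1 * mu2 = D at hDs ⊢
    field_simp
  have hmap : IsProbabilityMeasure ((π.prod ((expMeasure lam1).prod ν)).map
      (fun p : ℝ × ℝ × ℝ => max (p.1 - p.2.1) 0 + p.2.2)) :=
    Measure.isProbabilityMeasure_map (by fun_prop)
  refine ⟨hprob, measure_eq_of_mgf_eventuallyEq ?_ ?_ ?_⟩
  · rw [mem_interior_iff_mem_nhds]
    filter_upwards [hstep] with s hs using integrable_exp_of_lintegral_eq hs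
  · rw [mem_interior_iff_mem_nhds]
    filter_upwards [eventually_lt_nhds hα2] with s hs using hI s hs
  · filter_upwards [hstep] with s hs using mgf_eq_of_lintegral_eq mgf_nonneg hs

end

end MG1

theorem lemma3
    (lam1 lam2 mu1 mu2 : ℝ) (hlam1 : 0 < lam1) (hlam2 : 0 < lam2) (hmu1 : 0 < mu1) (hmu2 : 0 < mu2)
    (hstab : mu1 > lam1 * (1 + lam2 / mu2))
    (ν : Measure ℝ) [IsProbabilityMeasure ν] (hν : ∀ᵐ y ∂ν, 0 ≤ y)
    (hmgf : ∀ᶠ s in 𝓝 (0 : ℝ),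
      mgf id ν s = mu1 * (mu2 - s) / (s ^ 2 - s * (mu2 + mu1 + lam2) + mu1 * mu2)) :
    ∃ α1 α2 ρ C1 C2 : ℝ,
      -- the two roots of the quadratic
      α1 > α2 ∧ α2 > 0 ∧
      (∀ s : ℝ, s ^ 2 - s * (mu1 + mu2 + lam2 - lam1) + mu1 * mu2 - lam1 * mu2 - lam1 * lam2 = 0 ↔
        s = α1 ∨ s = α2) ∧
      -- the load and the two coefficients
      Integrable id ν ∧ ρ = lam1 * ∫ y, y ∂ν ∧ ρ = lam1 * (mu2 + lam2) / (mu1 * mu2) ∧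
      C1 = (1 - ρ) * mu1 * (mu2 - α1) / (α1 - α2) ∧
      C2 = (1 - ρ) * mu1 * (mu2 - α2) / (α2 - α1) ∧
      -- the function is nonnegative on `[0, ∞)`
      (∀ t : ℝ, 0 ≤ t → 0 ≤ -C1 * Real.exp (-α1 * t) - C2 * Real.exp (-α2 * t)) ∧
      -- the law with this density is the unique stationary law of the system time
      (∀ π : Measure ℝ, MG1.IsStationaryLaw lam1 ν π ↔
        π = MG1.lawOfDensity
          (fun t => -C1 * Real.exp (-α1 * t) - C2 * Real.exp (-α2 * t))) ∧
      -- it is the limit law of the system time of the `j`-th packet, from any initial backlog `W`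
      (∀ (Ω : Type*) [MeasurableSpace Ω] (P : Measure Ω) [IsProbabilityMeasure P]
        (X Y : ℕ → Ω → ℝ) (W : Ω → ℝ),
        MG1.IsInput P lam1 ν X Y → AEMeasurable W P →
        ∃ _ : IsProbabilityMeasure (MG1.lawOfDensity
            (fun t => -C1 * Real.exp (-α1 * t) - C2 * Real.exp (-α2 * t))),
          TendstoInDistribution
            (fun (j : ℕ) (ω : Ω) => MG1.systemTime (W ω) (fun i => X i ω) (fun i => Y i ω) j)
            atTop id (fun _ => P)
            (MG1.lawOfDensity
              (fun t => -C1 * Real.exp (-α1 * t) - C2 * Real.exp (-α2 * t)))) := by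
  -- the product of the two roots is positive by the stability condition
  have hstab' : 0 < mu1 * mu2 - lam1 * mu2 - lam1 * lam2 := by
    have := mul_lt_mul_of_pos_right hstab hmu2
    field_simp at this
    linarith
  obtain ⟨α1, α2, hα2, hα2', hα1, hsum, hprod⟩ := MG1.exists_roots_of_neg hmu2 hstab'
    (b := mu1 + mu2 + lam2 - lam1) (by nlinarith [mul_pos hlam1 hlam2, mul_pos hlam2 hmu2])
  have hα : α1 ≠ α2 := by linarith
  obtain ⟨hint, hmean⟩ := MG1.service_mean hmu1 hmu2 hmgf
  obtain ⟨hXint, hXmean⟩ := MG1.expMeasure_mean hlam1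
  have hlt : ∫ y, y ∂ν < ∫ x, x ∂expMeasure lam1 := by
    rw [hmean, hXmean, div_lt_div_iff₀ (by positivity) hlam1]
    linarith
  set ρ := lam1 * (mu2 + lam2) / (mu1 * mu2) with hρ
  set C1 := (1 - ρ) * mu1 * (mu2 - α1) / (α1 - α2) with hC1
  set C2 := (1 - ρ) * mu1 * (mu2 - α2) / (α2 - α1) with hC2
  have hC1' : -C1 = (1 - ρ) * mu1 * (α1 - mu2) / (α1 - α2) := by
    rw [hC1]; ring
  have hC2' : -C2 = (1 - ρ) * mu1 * (mu2 - α2) / (α1 - α2) := by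
    rw [hC2, ← neg_sub α1 α2, div_neg, neg_neg]
  obtain ⟨h1, h2, hstat⟩ := MG1.isStationaryLaw_lawOfDensity hlam1 hmu1 hmu2 hmgf hα2 hα2' hα1
    hsum hprod hρ hC1' hC2'
  have hf : (fun t => -C1 * Real.exp (-α1 * t) + -C2 * Real.exp (-α2 * t))
      = fun t => -C1 * Real.exp (-α1 * t) - C2 * Real.exp (-α2 * t) := by
    funext t; ring
  rw [hf] at hstat
  refine ⟨α1, α2, ρ, C1, C2, by linarith, hα2, fun s => ?_, hint, ?_, rfl, rfl, rfl, fun t _ => ?_,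
    fun π => ⟨fun hπ => ?_, fun hπ => hπ ▸ hstat⟩, fun Ω _ P _ X Y W hXY hW => ?_⟩
  · have : s ^ 2 - s * (mu1 + mu2 + lam2 - lam1) + mu1 * mu2 - lam1 * mu2 - lam1 * lam2
        = (s - α1) * (s - α2) := by
      linear_combination s * hsum - hprod
    rw [this, mul_eq_zero, sub_eq_zero, sub_eq_zero]
  · rw [hmean, hρ]; ring
  · rw [← congrFun hf t]
    positivity
  · exact hπ.unique hlam1 hν hXint hint hlt hstat
  · have := hstat.isProbabilityMeasure
    exact ⟨this, hstat.tendstoInDistribution_systemTime hlam1 hν hXint hint hlt hXY hW⟩
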